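/- **Dependency structures.** A *dependency structure with choice* (DSC) is a finite set $E$ of events with a map $D:E\to\mathcal P(\mathcal P(E))$, each $D(e)$ nonempty, such that every $X\in D(e)$ (a *possible dependency set* of $e$) satisfies $e\notin X$ and is *complete*: each $x\in X$ has some $Y\in D(x)$ with $Y\subseteq X$. The set $D(e)$ is read as a predicate in disjunctive normal form, which holds of $X\subseteq E$ iff $Y\subseteq X$ for some $Y\in D(e)$. Two DSCs are *equivalent* if some bijection of their event sets carries the predicate of every event to a logically equivalent one. A DSC is *irredundant* if no possible dependency set of an event properly contains another possible dependency set of that event; every DSC is equivalent to an irredundant one. A *renaming* between $(E,D)$ and $(E',D')$ is a bijection $f:E\to E'$ with $D'(f(e))=\{f(X)\mid X\in D(e)\}$ for all $e$. On subsets of $E$ let $\le$ be the least reflexive and transitive relation such that $Y\le X$ whenever $Y\subset X$ and each $e\in X$ has a possible dependency set contained in $Y$. The *reachable dependency poset* $rdp(E,D)$ consists of the sets $X$ with $\emptyset\le X$, ordered by $\le$. **Posites.** A *finite posite* is a finite poset $P$ with a nucleus $j$ on the frame $\mathcal O(P)$ of its downsets. Two posites are isomorphic if there is an isomorphism of their frames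 of downsets that commutes with the nuclei. An element of a poset is *join-irreducible* if it belongs to every set of which it is the join (so a least element is not join-irreducible). The *Bruns–Lakser topology* on $\mathcal O(P)$ is the nucleus $$bl(U)=\{x\in P\mid a\in U\text{ for every join-irreducible } a\le x\}.$$ If $P$ is a finite lattice, its closed elements are exactly the downsets that contain the join $\bigvee S$ of each of their admissible subsets $S$, where $S$ is admissible if $x\wedge\bigvee S=\bigvee_{s\in S}(x\wedge s)$ for all $x$. **Theorem.** The assignment $(E,D)\mapsto(rdp(E,D),bl)$ induces a bijection from the set of equivalence classes of DSCs onto the set of isomorphism classes of the posites $(L,bl)$, where $L$ ranges over the nonempty finite upper semimodular lattices that have no sublattice isomorphic to $M_3$. The same assignment induces a bijection from the set of irredundant DSCs up to renaming onto the same set of isomorphism classes of posites. -/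

import Mathlib

universe u

namespace DepChoice

/-! Dependency structures with choice -/

/-- A pre-dependency structure with choice: a finite set of events, each with a nonempty
collection of possible dependency sets. -/
structure PreDSC where
  Event : Type u
  [finite : Finite Event]
  dep : Event → Set (Set Event)
  dep_nonempty : ∀ e, (dep e).Nonempty

attribute [instance] PreDSC.finite

/-- The dependency requirement `dep e`, read as a predicate in disjunctive normal form, is
satisfied by the event set `X`: some possible dependency set of `e` is contained in `X`. -/
def PreDSC.Enables (A : PreDSC.{u}) (X : Set A.Event) (e : A.Event) : Prop :=
  ∃ Y ∈ A.dep e, Y ⊆ X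

/-- An event set is complete if it contains a possible dependency set of each of its elements. -/
def PreDSC.IsComplete (A : PreDSC.{u}) (X : Set A.Event) : Prop :=
  ∀ e ∈ X, A.Enables X e

/-- A dependency structure with choice. -/
structure DSC extends PreDSC.{u} where
  dep_complete : ∀ e, ∀ X ∈ dep e, toPreDSC.IsComplete X
  dep_acyclic : ∀ e, ∀ X ∈ dep e, e ∉ X

/-- Equality of dependency structures up to renaming of events, where the dependencies of an
event count as a predicate on event sets, up to logical equivalence. -/
def DSC.Equivalent (A B : DSC.{u}) : Prop :=
  ∃ f : A.Event ≃ B.Event, ∀ (e : A.Event) (X : Set A.Event),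
    A.Enables X e ↔ B.Enables (f '' X) (f e)

instance DSC.setoid : Setoid DSC.{u} where
  r := DSC.Equivalent
  iseqv :=
    { refl := fun A => ⟨Equiv.refl _, fun e X => by simp⟩
      symm := by
        rintro A B ⟨f, hf⟩
        refine ⟨f.symm, fun e X => ?_⟩
        rw [hf (f.symm e) (f.symm '' X)]
        simp
      trans := by
        rintro A B C ⟨f, hf⟩ ⟨g, hg⟩
        refine ⟨f.trans g, fun e X => ?_⟩
        rw [hf e X, hg (f e) (f '' X), Set.image_image]
        rfl }

/-- Irredundant: no possible dependency set of an event properly contains another one. -/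
def DSC.IsIrredundant (A : DSC.{u}) : Prop :=
  ∀ e, ∀ X ∈ A.dep e, ∀ Y ∈ A.dep e, X ⊆ Y → X = Y

/-- Literal equality of dependency structures up to renaming of events. -/
def DSC.Renaming (A B : DSC.{u}) : Prop :=
  ∃ f : A.Event ≃ B.Event, ∀ e : A.Event, B.dep (f e) = (fun X => f '' X) '' A.dep e

instance DSC.irredundantSetoid : Setoid {A : DSC.{u} // A.IsIrredundant} where
  r A B := DSC.Renaming A.1 B.1
  iseqv :=
    { refl := fun A => ⟨Equiv.refl _, fun e => by simp⟩
      symm := by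
        rintro A B ⟨f, hf⟩
        refine ⟨f.symm, fun e => ?_⟩
        have h := hf (f.symm e)
        rw [Equiv.apply_symm_apply] at h
        rw [h, Set.image_image]
        simp
      trans := by
        rintro A B C ⟨f, hf⟩ ⟨g, hg⟩
        refine ⟨f.trans g, fun e => ?_⟩
        rw [Equiv.trans_apply, hg, hf, Set.image_image]
        simp [Set.image_image] }

/-! The reachable dependency poset -/

/-- The relation generating the order: `X` lies above `Y` if `Y ⊂ X` and every element of `X`
has a possible dependency set contained in `Y`. -/
def PreDSC.Step (A : PreDSC.{u}) (Y X : Set A.Event) : Prop :=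
  Y ⊂ X ∧ ∀ e ∈ X, A.Enables Y e

/-- The event sets that lie above the empty event set. -/
def PreDSC.Reachable (A : PreDSC.{u}) (X : Set A.Event) : Prop :=
  Relation.ReflTransGen A.Step ∅ X

/-- The reachable dependency poset. -/
def PreDSC.Rdp (A : PreDSC.{u}) : Type u := {X : Set A.Event // A.Reachable X}

theorem PreDSC.subset_of_steps {A : PreDSC.{u}} {X Y : Set A.Event}
    (h : Relation.ReflTransGen A.Step X Y) : X ⊆ Y := by
  induction h with
  | refl => exact subset_rfl
  | tail _ h ih => exact ih.trans h.1.subset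

instance (A : PreDSC.{u}) : PartialOrder A.Rdp where
  le X Y := Relation.ReflTransGen A.Step X.1 Y.1
  le_refl _ := Relation.ReflTransGen.refl
  le_trans _ _ _ h₁ h₂ := Relation.ReflTransGen.trans h₁ h₂
  le_antisymm _ _ h₁ h₂ :=
    Subtype.ext (Set.Subset.antisymm (PreDSC.subset_of_steps h₁) (PreDSC.subset_of_steps h₂))

instance (A : PreDSC.{u}) : Finite A.Rdp :=
  inferInstanceAs (Finite {X : Set A.Event // A.Reachable X})

/-! Posites -/

/-- A finite posite: a finite poset with a nucleus on the frame of its downsets. -/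
structure FinPosite where
  Carrier : Type u
  [order : PartialOrder Carrier]
  [finite : Finite Carrier]
  topology : Nucleus (LowerSet Carrier)

attribute [instance] FinPosite.order FinPosite.finite

/-- Isomorphism of posites: an isomorphism of the frames of downsets which carries one nucleus
to the other. -/
instance FinPosite.setoid : Setoid FinPosite.{u} where
  r P Q := ∃ φ : LowerSet P.Carrier ≃o LowerSet Q.Carrier,
    ∀ U, φ (P.topology U) = Q.topology (φ U)
  iseqv :=
    { refl := fun P => ⟨OrderIso.refl _, fun U => rfl⟩
      symm := by
        rintro P Q ⟨φ, h⟩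
        refine ⟨φ.symm, fun U => ?_⟩
        rw [OrderIso.symm_apply_eq, h, OrderIso.apply_symm_apply]
      trans := by
        rintro P Q R ⟨φ, h⟩ ⟨ψ, k⟩
        refine ⟨φ.trans ψ, fun U => ?_⟩
        simp only [OrderIso.trans_apply]
        rw [h, k] }

/-! The Bruns-Lakser topology -/

/-- An element of a poset is join-irreducible if every set whose join it is contains it.
(A globally least element is the join of the empty set, hence not join-irreducible.) -/
def JoinIrreducible {P : Type u} [PartialOrder P] (x : P) : Prop :=
  ∀ S : Set P, IsLUB S x → x ∈ S

/-- The Bruns-Lakser topology on the downsets of `P`: an element is covered by a downset as soon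
as all join-irreducible elements below it lie in that downset. -/
def brunsLakser (P : Type u) [PartialOrder P] : Nucleus (LowerSet P) where
  toFun U := ⟨{x | ∀ a, JoinIrreducible a → a ≤ x → a ∈ U},
    fun _ _ hyx hx a ha hay => hx a ha (hay.trans hyx)⟩
  map_inf' U V := by
    ext x
    exact ⟨fun h => ⟨fun a ha hax => (h a ha hax).1, fun a ha hax => (h a ha hax).2⟩,
      fun h a ha hax => ⟨h.1 a ha hax, h.2 a ha hax⟩⟩
  idempotent' _ _ hx a ha hax := hx a ha hax a ha le_rfl
  le_apply' U _ hx _ _ hax := U.lower hax hx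

/-- The set `S` with join `s` is admissible: `x ⊓ s` is the join of `x ⊓ S` for every `x`. -/
def IsAdmissible {L : Type u} [Lattice L] (S : Set L) (s : L) : Prop :=
  IsLUB S s ∧ ∀ x, IsLUB ((fun t => x ⊓ t) '' S) (x ⊓ s)

/-- In a finite lattice, the downsets closed for `brunsLakser` are exactly those which are closed
under joins of admissible sets, as in the original construction of Bruns and Lakser. -/
theorem brunsLakser_eq_self_iff {L : Type u} [Lattice L] [Finite L] (U : LowerSet L) :
    brunsLakser L U = U ↔ ∀ S s, IsAdmissible S s → S ⊆ (U : Set L) → s ∈ U := by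
  constructor
  · intro hU S s hS hSU
    rw [← hU]
    intro a ha has
    have h := hS.2 a
    rw [inf_eq_left.mpr has] at h
    obtain ⟨t, ht, hta⟩ := ha _ h
    exact U.lower (inf_eq_left.mp hta) (hSU ht)
  · intro h
    refine le_antisymm ?_ ((brunsLakser L).le_apply' U)
    intro x
    induction x using WellFoundedLT.induction with
    | ind x ih =>
      intro hx
      by_cases hi : JoinIrreducible x
      · exact hx x hi le_rfl
      · unfold JoinIrreducible at hi
        push Not at hi
        obtain ⟨S, hS, hxS⟩ := hi
        refine h {y | y < x} x ⟨?_, fun y => ⟨?_, fun b hb => ?_⟩⟩ ?_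
        · exact ⟨fun y hy => le_of_lt hy, fun b hb => hS.2 fun t ht =>
            hb (lt_of_le_of_ne (hS.1 ht) fun e => hxS (e ▸ ht))⟩
        · rintro _ ⟨t, ht, rfl⟩
          exact inf_le_inf_left y (le_of_lt ht)
        · by_cases hyx : x ≤ y
          · rw [inf_eq_right.mpr hyx]
            refine hS.2 fun t ht => hb ⟨t, lt_of_le_of_ne (hS.1 ht) fun e => hxS (e ▸ ht), ?_⟩
            exact inf_eq_right.mpr ((hS.1 ht).trans hyx)
          · refine hb ⟨y ⊓ x, lt_of_le_of_ne inf_le_right fun e => hyx (inf_eq_right.mp e), ?_⟩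
            simp
        · intro y hy
          exact ih y hy ((brunsLakser L U).lower (le_of_lt hy) hx)

/-- `L` has no sublattice isomorphic to the diamond `M₃`. -/
def IsM3Free (L : Type u) [Lattice L] : Prop :=
  ¬ ∃ a b c : L, a ≠ b ∧ b ≠ c ∧ a ≠ c ∧
    a ⊔ b = b ⊔ c ∧ b ⊔ c = a ⊔ c ∧ a ⊓ b = b ⊓ c ∧ b ⊓ c = a ⊓ c

/-- A finite poset, made into a posite by the Bruns-Lakser topology on its downsets. -/
def FinPosite.ofPoset (P : Type u) [PartialOrder P] [Finite P] : FinPosite.{u} where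
  Carrier := P
  topology := brunsLakser P

/-- The set of finite posites, up to isomorphism, which are given by the downsets of a (nonempty)
finite upper semimodular lattice without `M₃` and the Bruns-Lakser topology. -/
def brunsLakserPosites : Set (Quotient FinPosite.setoid.{u}) :=
  {c | ∃ (L : Type u) (_ : Lattice L) (_ : Finite L) (_ : Nonempty L),
    IsUpperModularLattice L ∧ IsM3Free L ∧ c = Quotient.mk _ (FinPosite.ofPoset L)}

end DepChoice

namespace DepChoice

/-! The reachable sets of a DSC are exactly its complete sets, and `≤` on them is inclusion. They
are closed under union and satisfy an exchange property (`exists_enables_of_not_subset`): in effect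
they form an antimatroid. Covers therefore add exactly one event, which gives upper semimodularity
and excludes `M₃`. The lattice determines the structure: an event `e` is recovered from the largest
complete set avoiding it, and the complete sets determine all the predicates (`enables_iff`). So
equivalence of DSCs is order isomorphism of their posets. Conversely, in a finite upper semimodular
`M₃`-free lattice, `x` is encoded by the set of inf-irreducibles not above it. Joins become unions
and each cover adds a single inf-irreducible (`infIrredNotAbove_eq_insert`), so these sets are the
complete sets of a DSC (`exists_rdp_orderIso`). Finally, a posite isomorphism of Bruns–Lakser
posites amounts to an isomorphism of posets, and each equivalence class of DSCs has one irredundant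
member up to renaming. -/

/-! ### Complete event sets and exchange. -/

theorem PreDSC.Enables.mono {A : PreDSC.{u}} {X Y : Set A.Event} {e : A.Event}
    (h : A.Enables X e) (hXY : X ⊆ Y) : A.Enables Y e :=
  let ⟨Z, hZ, hZX⟩ := h
  ⟨Z, hZ, hZX.trans hXY⟩

theorem PreDSC.IsComplete.sUnion {A : PreDSC.{u}} {S : Set (Set A.Event)}
    (h : ∀ X ∈ S, A.IsComplete X) : A.IsComplete (⋃₀ S) := by
  rintro e ⟨X, hX, he⟩
  exact (h X hX e he).mono (Set.subset_sUnion_of_mem hX)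

theorem PreDSC.IsComplete.union {A : PreDSC.{u}} {X Y : Set A.Event}
    (hX : A.IsComplete X) (hY : A.IsComplete Y) : A.IsComplete (X ∪ Y) := by
  rintro e (he | he)
  · exact (hX e he).mono Set.subset_union_left
  · exact (hY e he).mono Set.subset_union_right

theorem PreDSC.IsComplete.insert {A : PreDSC.{u}} {X : Set A.Event} {e : A.Event}
    (hX : A.IsComplete X) (he : A.Enables X e) : A.IsComplete (insert e X) := by
  rintro x (rfl | hx)
  · exact he.mono (Set.subset_insert _ _)
  · exact (hX x hx).mono (Set.subset_insert _ _)

/-- An event set enables `e` iff it contains, up to `e` itself, a complete set around `e`. -/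
theorem DSC.enables_iff (A : DSC.{u}) {X : Set A.Event} {e : A.Event} :
    A.Enables X e ↔ ∃ Z, A.IsComplete Z ∧ e ∈ Z ∧ Z ⊆ insert e X := by
  constructor
  · rintro ⟨Y, hY, hYX⟩
    exact ⟨insert e Y, (A.dep_complete e Y hY).insert ⟨Y, hY, subset_rfl⟩,
      Set.mem_insert _ _, Set.insert_subset_insert hYX⟩
  · rintro ⟨Z, hZ, heZ, hZX⟩
    obtain ⟨Y, hY, hYZ⟩ := hZ e heZ
    refine ⟨Y, hY, fun y hy => (hZX (hYZ hy)).resolve_left ?_⟩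
    rintro rfl
    exact A.dep_acyclic _ Y hY hy

/-- The exchange property of the complete event sets. -/
theorem DSC.exists_enables_of_not_subset (A : DSC.{u}) {X Y : Set A.Event}
    (hY : A.IsComplete Y) (h : ¬ Y ⊆ X) : ∃ e ∈ Y, e ∉ X ∧ A.Enables X e := by
  induction Y using WellFoundedLT.induction with
  | ind Y ih =>
    obtain ⟨e, he, heX⟩ := Set.not_subset.mp h
    obtain ⟨Z, hZ, hZY⟩ := hY e he
    by_cases hZX : Z ⊆ X
    · exact ⟨e, he, heX, Z, hZ, hZX⟩
    -- Acyclicity makes the descent strict: `e` lies in `Y` but not in `Z`.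
    · have hlt : Z < Y := lt_of_le_of_ne hZY fun hEq => A.dep_acyclic e Z hZ (hEq ▸ he)
      obtain ⟨x, hx, h'⟩ := ih Z hlt (A.dep_complete e Z hZ) hZX
      exact ⟨x, hZY hx, h'⟩

/-- Exchange supplies an event of `Y` to add to `X` while keeping it complete; hence the generated
order agrees with inclusion. -/
theorem DSC.steps_of_subset (A : DSC.{u}) {X Y : Set A.Event} (hX : A.IsComplete X)
    (hY : A.IsComplete Y) (h : X ⊆ Y) : Relation.ReflTransGen A.Step X Y := by
  induction X using WellFoundedGT.induction with
  | ind X ih =>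
    by_cases hYX : Y ⊆ X
    · rw [h.antisymm hYX]
    · obtain ⟨e, heY, heX, he⟩ := A.exists_enables_of_not_subset hY hYX
      refine .head ⟨Set.ssubset_insert heX, ?_⟩
        (ih _ (Set.ssubset_insert heX) (hX.insert he) (Set.insert_subset heY h))
      rintro x (rfl | hx)
      · exact he
      · exact hX x hx

theorem PreDSC.isComplete_of_reachable {A : PreDSC.{u}} {X : Set A.Event}
    (h : A.Reachable X) : A.IsComplete X := by
  cases h with
  | refl => exact fun e he => he.elim
  | tail _ h => exact fun e he => (h.2 e he).mono h.1.subset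

theorem DSC.reachable_iff (A : DSC.{u}) {X : Set A.Event} :
    A.Reachable X ↔ A.IsComplete X :=
  ⟨PreDSC.isComplete_of_reachable,
    fun h => A.steps_of_subset (fun _ he => he.elim) h (Set.empty_subset X)⟩

theorem PreDSC.Rdp.isComplete {A : PreDSC.{u}} (X : A.Rdp) : A.IsComplete X.1 :=
  PreDSC.isComplete_of_reachable X.2

theorem DSC.rdp_le_iff (A : DSC.{u}) {X Y : A.Rdp} : X ≤ Y ↔ X.1 ⊆ Y.1 :=
  ⟨PreDSC.subset_of_steps, A.steps_of_subset X.isComplete Y.isComplete⟩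

/-! ### The lattice of complete event sets. -/

/-- A complete event set, as an element of the reachable dependency poset. -/
def DSC.mkRdp (A : DSC.{u}) (X : Set A.Event) (h : A.IsComplete X) : A.Rdp :=
  ⟨X, A.reachable_iff.mpr h⟩

/-- The union of all complete subsets of an event set. -/
def DSC.core (A : DSC.{u}) (X : Set A.Event) : A.Rdp :=
  A.mkRdp (⋃₀ {Y | A.IsComplete Y ∧ Y ⊆ X}) (PreDSC.IsComplete.sUnion fun _ h => h.1)

theorem DSC.core_subset (A : DSC.{u}) (X : Set A.Event) : (A.core X).1 ⊆ X :=
  Set.sUnion_subset fun _ h => h.2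

theorem DSC.le_core_iff (A : DSC.{u}) {X : Set A.Event} {Y : A.Rdp} :
    Y ≤ A.core X ↔ Y.1 ⊆ X :=
  ⟨fun h => (A.rdp_le_iff.mp h).trans (A.core_subset X),
    fun h => A.rdp_le_iff.mpr (Set.subset_sUnion_of_mem ⟨Y.isComplete, h⟩)⟩

/-- The reachable dependency poset of a dependency structure with choice is a lattice. -/
instance DSC.rdpLattice (A : DSC.{u}) : Lattice A.Rdp where
  sup X Y := A.mkRdp (X.1 ∪ Y.1) (X.isComplete.union Y.isComplete)
  le_sup_left _ _ := A.rdp_le_iff.mpr Set.subset_union_left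
  le_sup_right _ _ := A.rdp_le_iff.mpr Set.subset_union_right
  sup_le _ _ _ h₁ h₂ :=
    A.rdp_le_iff.mpr (Set.union_subset (A.rdp_le_iff.mp h₁) (A.rdp_le_iff.mp h₂))
  -- An intersection of complete sets need not be complete, so the meet is its core.
  inf X Y := A.core (X.1 ∩ Y.1)
  inf_le_left _ _ := A.rdp_le_iff.mpr ((A.core_subset _).trans Set.inter_subset_left)
  inf_le_right _ _ := A.rdp_le_iff.mpr ((A.core_subset _).trans Set.inter_subset_right)
  le_inf _ _ _ h₁ h₂ :=
    A.le_core_iff.mpr (Set.subset_inter (A.rdp_le_iff.mp h₁) (A.rdp_le_iff.mp h₂))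

theorem DSC.rdp_sup_val (A : DSC.{u}) (X Y : A.Rdp) : (X ⊔ Y).1 = X.1 ∪ Y.1 := rfl

theorem DSC.rdp_covBy_of_eq_insert (A : DSC.{u}) {X Y : A.Rdp} {e : A.Event} (he : e ∉ X.1)
    (h : Y.1 = insert e X.1) : X ⋖ Y := by
  refine ⟨lt_of_le_of_ne (A.rdp_le_iff.mpr (h ▸ Set.subset_insert _ _)) ?_, fun Z hXZ hZY => ?_⟩
  · rintro rfl
    exact he (h ▸ Set.mem_insert _ _)
  · have h₁ := A.rdp_le_iff.mp hXZ.le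
    have h₂ := A.rdp_le_iff.mp hZY.le
    by_cases heZ : e ∈ Z.1
    · exact hZY.not_ge (A.rdp_le_iff.mpr (h ▸ Set.insert_subset heZ h₁))
    · refine hXZ.not_ge (A.rdp_le_iff.mpr fun z hz => ?_)
      have := h₂ hz
      rw [h] at this
      exact this.resolve_left fun hEq => heZ (hEq ▸ hz)

/-- The exchange property, in the reachable dependency poset. -/
theorem DSC.rdp_exists_insert_le (A : DSC.{u}) {X Y : A.Rdp} (h : ¬ Y ≤ X) :
    ∃ e ∈ Y.1, e ∉ X.1 ∧ ∃ Z : A.Rdp, Z.1 = insert e X.1 := by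
  obtain ⟨e, heY, heX, he⟩ :=
    A.exists_enables_of_not_subset Y.isComplete (mt A.rdp_le_iff.mpr h)
  exact ⟨e, heY, heX, A.mkRdp _ (X.isComplete.insert he), rfl⟩

theorem DSC.exists_eq_insert_of_rdp_covBy (A : DSC.{u}) {X Y : A.Rdp} (h : X ⋖ Y) :
    ∃ e, e ∉ X.1 ∧ Y.1 = insert e X.1 := by
  obtain ⟨e, heY, heX, Z, hZ⟩ := A.rdp_exists_insert_le h.lt.not_ge
  refine ⟨e, heX, ?_⟩
  have hXZ := (A.rdp_covBy_of_eq_insert heX hZ).lt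
  have hZY : Z ≤ Y :=
    A.rdp_le_iff.mpr (hZ ▸ Set.insert_subset heY (A.rdp_le_iff.mp h.le))
  rw [← hZ, hZY.eq_of_not_lt (h.2 hXZ)]

theorem DSC.isUpperModularLattice_rdp (A : DSC.{u}) : IsUpperModularLattice A.Rdp where
  covBy_sup_of_inf_covBy {X Y} h := by
    obtain ⟨e, he, hX⟩ := A.exists_eq_insert_of_rdp_covBy h
    have hinf : (X ⊓ Y).1 ⊆ Y.1 := A.rdp_le_iff.mp inf_le_right
    refine A.rdp_covBy_of_eq_insert (e := e) (fun heY => ?_) ?_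
    · refine h.lt.ne (inf_eq_left.mpr (A.rdp_le_iff.mpr ?_))
      rw [hX]
      exact Set.insert_subset heY hinf
    · rw [A.rdp_sup_val, hX, Set.insert_union, Set.union_eq_right.mpr hinf]

/-- In a copy of `M₃`, exchange adds to `X ⊓ Y` some `e ∈ X`, giving a complete `W`. Since joins are
unions, `e` lies in `Y` or `Z`; then `W` lies below `X` and that element, hence below their common
meet, which omits `e`. -/
theorem DSC.isM3Free_rdp (A : DSC.{u}) : IsM3Free A.Rdp := by
  rintro ⟨X, Y, Z, -, hYZ, -, h₁, h₂, h₃, h₄⟩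
  have hX : ¬ X ≤ X ⊓ Y := fun h => by
    have hXY := h.trans inf_le_right
    have hXZ := (h.trans (h₃.trans h₄).le).trans inf_le_right
    refine hYZ ?_
    rw [← sup_eq_right.mpr hXY, ← sup_eq_right.mpr hXZ, h₁, h₂, sup_eq_right.mpr hXZ]
  obtain ⟨e, heX, he, W, hW⟩ := A.rdp_exists_insert_le hX
  have key : ∀ V : A.Rdp, X ⊓ Y ≤ V → e ∈ V.1 → W ≤ V := fun V hV heV =>
    A.rdp_le_iff.mpr (hW ▸ Set.insert_subset heV (A.rdp_le_iff.mp hV))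
  have hWX := key X inf_le_left heX
  have heW : e ∈ W.1 := hW ▸ Set.mem_insert _ _
  have heYZ : e ∈ (Y ⊔ Z).1 := A.rdp_le_iff.mp (h₁ ▸ le_sup_left) heX
  rcases heYZ with heY | heZ
  · exact he (A.rdp_le_iff.mp (le_inf hWX (key Y inf_le_right heY)) heW)
  · refine he ?_
    rw [h₃.trans h₄]
    exact A.rdp_le_iff.mp
      (le_inf hWX (key Z ((h₃.trans h₄).le.trans inf_le_right) heZ)) heW

instance DSC.rdpNonempty (A : DSC.{u}) : Nonempty A.Rdp := ⟨A.core ∅⟩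

/-! Recovering the events from the order -/

/-- The largest complete event set which avoids `e`. -/
def DSC.avoiding (A : DSC.{u}) (e : A.Event) : A.Rdp := A.core {e}ᶜ

theorem DSC.le_avoiding_iff (A : DSC.{u}) {e : A.Event} {X : A.Rdp} :
    X ≤ A.avoiding e ↔ e ∉ X.1 :=
  A.le_core_iff.trans Set.subset_compl_singleton_iff

/-- Any possible dependency set of `e` is complete and omits `e`, so it lies inside `A.avoiding e`,
which therefore enables `e`. -/
theorem DSC.exists_eq_insert_avoiding (A : DSC.{u}) (e : A.Event) :
    ∃ X : A.Rdp, X.1 = insert e (A.avoiding e).1 := by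
  obtain ⟨Y, hY⟩ := A.dep_nonempty e
  have hYe : A.mkRdp Y (A.dep_complete e Y hY) ≤ A.avoiding e :=
    A.le_avoiding_iff.mpr (A.dep_acyclic e Y hY)
  exact ⟨A.mkRdp _ ((A.avoiding e).isComplete.insert ⟨Y, hY, A.rdp_le_iff.mp hYe⟩), rfl⟩

theorem DSC.event_ext (A : DSC.{u}) {e f : A.Event} (h : ∀ X : A.Rdp, e ∈ X.1 ↔ f ∈ X.1) :
    e = f := by
  obtain ⟨X, hX⟩ := A.exists_eq_insert_avoiding e
  have hf : f ∈ X.1 := (h X).mp (hX ▸ Set.mem_insert _ _)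
  rw [hX] at hf
  refine (hf.resolve_right fun hf => ?_).symm
  exact A.le_avoiding_iff.mp le_rfl ((h _).mpr hf)

/-- The cover that adds `e` to `A.avoiding e` is sent to a cover, and `f` is the one event added
there. Membership transfers because `e ∈ X` fails exactly when `X ≤ A.avoiding e`. -/
theorem DSC.exists_event_of_rdp_orderIso {A B : DSC.{u}} (φ : A.Rdp ≃o B.Rdp) (e : A.Event) :
    ∃ f : B.Event, ∀ X, e ∈ X.1 ↔ f ∈ (φ X).1 := by
  obtain ⟨Y, hY⟩ := A.exists_eq_insert_avoiding e
  have he : e ∉ (A.avoiding e).1 := A.le_avoiding_iff.mp le_rfl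
  obtain ⟨f, hf, hfY⟩ := B.exists_eq_insert_of_rdp_covBy
    ((apply_covBy_apply_iff φ).mpr (A.rdp_covBy_of_eq_insert he hY))
  refine ⟨f, fun X => ⟨fun heX => ?_, fun hfX => ?_⟩⟩
  · have hle : Y ≤ X ⊔ A.avoiding e :=
      A.rdp_le_iff.mpr (hY ▸ Set.insert_subset (Or.inl heX) Set.subset_union_right)
    have hle' := φ.monotone hle
    rw [φ.map_sup] at hle'
    have hfm : f ∈ (φ Y).1 := hfY ▸ Set.mem_insert _ _
    exact (B.rdp_le_iff.mp hle' hfm).resolve_right hf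
  · by_contra heX
    exact hf (B.rdp_le_iff.mp (φ.monotone (A.le_avoiding_iff.mpr heX)) hfX)

theorem DSC.exists_equiv_of_rdp_orderIso {A B : DSC.{u}} (φ : A.Rdp ≃o B.Rdp) :
    ∃ f : A.Event ≃ B.Event, ∀ X, (φ X).1 = f '' X.1 := by
  choose f hf using DSC.exists_event_of_rdp_orderIso φ
  choose g hg using DSC.exists_event_of_rdp_orderIso φ.symm
  refine ⟨⟨f, g, fun e => A.event_ext fun X => ?_, fun e => B.event_ext fun X => ?_⟩,
    fun X => ?_⟩
  · rw [hf e X, hg (f e) (φ X), φ.symm_apply_apply]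
  · rw [hg e X, hf (g e) (φ.symm X), φ.apply_symm_apply]
  · ext b
    rw [Equiv.image_eq_preimage_symm]
    change b ∈ (φ X).1 ↔ g b ∈ X.1
    rw [hg, φ.symm_apply_apply]

theorem DSC.equivalent_of_isComplete_iff {A B : DSC.{u}} (f : A.Event ≃ B.Event)
    (h : ∀ X, A.IsComplete X ↔ B.IsComplete (f '' X)) : DSC.Equivalent A B := by
  refine ⟨f, fun e X => ?_⟩
  rw [A.enables_iff, B.enables_iff]
  constructor
  · rintro ⟨Z, hZ, he, hZX⟩
    refine ⟨f '' Z, (h Z).mp hZ, Set.mem_image_of_mem f he, ?_⟩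
    rw [← Set.image_insert_eq]
    exact Set.image_mono hZX
  · rintro ⟨Z, hZ, he, hZX⟩
    obtain ⟨Z, rfl⟩ := f.surjective.image_surjective Z
    rw [← Set.image_insert_eq, Set.image_subset_image_iff f.injective] at hZX
    exact ⟨Z, (h Z).mpr hZ, (f.injective.mem_set_image).mp he, hZX⟩

theorem DSC.isComplete_iff_of_enables_iff {A B : DSC.{u}} {f : A.Event ≃ B.Event}
    (h : ∀ e X, A.Enables X e ↔ B.Enables (f '' X) (f e)) (X : Set A.Event) :
    A.IsComplete X ↔ B.IsComplete (f '' X) := by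
  simp only [PreDSC.IsComplete, Set.forall_mem_image, h]

theorem DSC.equivalent_iff_nonempty_rdp_orderIso {A B : DSC.{u}} :
    DSC.Equivalent A B ↔ Nonempty (A.Rdp ≃o B.Rdp) := by
  constructor
  · rintro ⟨f, hf⟩
    have h := DSC.isComplete_iff_of_enables_iff hf
    refine ⟨(Equiv.subtypeEquiv (Equiv.Set.congr f) fun X => ?_ : A.Rdp ≃ B.Rdp), ?_⟩
    · rw [A.reachable_iff, B.reachable_iff]
      exact h X
    · intro X Y
      rw [A.rdp_le_iff, B.rdp_le_iff]
      exact Set.image_subset_image_iff f.injective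
  · rintro ⟨φ⟩
    obtain ⟨f, hf⟩ := DSC.exists_equiv_of_rdp_orderIso φ
    refine DSC.equivalent_of_isComplete_iff f fun X => ⟨fun hX => ?_, fun hX => ?_⟩
    · have := (φ (A.mkRdp X hX)).isComplete
      rwa [hf] at this
    · have hY := hf (φ.symm (B.mkRdp _ hX))
      rw [φ.apply_symm_apply] at hY
      have := (φ.symm (B.mkRdp _ hX)).isComplete
      rwa [← f.injective.image_injective hY] at this

/-! Irredundant dependency structures -/

/-- The predicate thus determines the family `dep e`, so equivalent irredundant structures are
renamings of each other. -/
theorem DSC.IsIrredundant.mem_dep_iff {A : DSC.{u}} (hA : A.IsIrredundant) {e : A.Event}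
    {X : Set A.Event} : X ∈ A.dep e ↔ Minimal (fun Y => A.Enables Y e) X := by
  constructor
  · refine fun hX => ⟨⟨X, hX, subset_rfl⟩, ?_⟩
    rintro Y ⟨Z, hZ, hZY⟩ hYX
    exact (hA e Z hZ X hX (hZY.trans hYX)) ▸ hZY
  · rintro ⟨⟨Y, hY, hYX⟩, hmin⟩
    rwa [subset_antisymm (hmin ⟨Y, hY, subset_rfl⟩ hYX) hYX]

theorem DSC.renaming_iff_equivalent {A B : DSC.{u}} (hA : A.IsIrredundant)
    (hB : B.IsIrredundant) : DSC.Renaming A B ↔ DSC.Equivalent A B := by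
  constructor
  · rintro ⟨f, hf⟩
    refine ⟨f, fun e X => ?_⟩
    simp [PreDSC.Enables, hf, Set.image_subset_image_iff f.injective]
  · rintro ⟨f, hf⟩
    refine ⟨f, fun e => ?_⟩
    ext X
    obtain ⟨X, rfl⟩ := f.surjective.image_surjective X
    rw [f.injective.image_injective.mem_set_image, hA.mem_dep_iff, hB.mem_dep_iff]
    simp only [Minimal, f.surjective.image_surjective.forall, ← hf,
      Set.image_subset_image_iff f.injective]

theorem DSC.exists_isIrredundant_equivalent (A : DSC.{u}) :
    ∃ B : DSC.{u}, B.IsIrredundant ∧ DSC.Equivalent B A := by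
  have hmin : ∀ e, ∀ X ∈ A.dep e, ∃ Y ⊆ X, Minimal (· ∈ A.dep e) Y := fun e X hX =>
    (Set.toFinite (A.dep e)).exists_le_minimal hX
  let B₀ : PreDSC.{u} :=
    { Event := A.Event
      dep := fun e => {X | Minimal (· ∈ A.dep e) X}
      dep_nonempty := fun e =>
        let ⟨X, hX⟩ := A.dep_nonempty e
        let ⟨Y, _, hY⟩ := hmin e X hX
        ⟨Y, hY⟩ }
  have henables : ∀ e X, B₀.Enables X e ↔ A.Enables X e := by
    refine fun e X => ⟨fun ⟨Y, hY, hYX⟩ => ⟨Y, hY.prop, hYX⟩, fun ⟨Y, hY, hYX⟩ => ?_⟩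
    obtain ⟨Z, hZY, hZ⟩ := hmin e Y hY
    exact ⟨Z, hZ, hZY.trans hYX⟩
  refine ⟨{ B₀ with
      dep_complete := fun e X hX x hx => (henables x X).mpr (A.dep_complete e X hX.prop x hx)
      dep_acyclic := fun e X hX => A.dep_acyclic e X hX.prop }, ?_, Equiv.refl _, fun e X => ?_⟩
  · exact fun e X hX Y hY hXY => hXY.antisymm (hY.le_of_le hX.prop hXY)
  · simpa using henables e X

/-! Upper semimodular lattices without `M₃` -/

section Lattice

variable {L : Type u} [Lattice L]

theorem covBy_sup_of_covBy_of_not_le [IsUpperModularLattice L] {x y z : L} (hxy : x ⋖ y)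
    (hxz : x ≤ z) (hyz : ¬ y ≤ z) : z ⋖ z ⊔ y := by
  have h : y ⊓ z = x := by
    refine (hxy.eq_or_eq (le_inf hxy.le hxz) inf_le_left).resolve_right fun h => hyz ?_
    exact inf_eq_left.mp h
  rw [sup_comm]
  exact covBy_sup_of_inf_covBy_left (h.symm ▸ hxy)

/-- Three distinct upper covers of an element, one below the join of the others, form `M₃`. -/
theorem IsM3Free.not_le_sup_of_covBy [IsUpperModularLattice L] (hL : IsM3Free L) {x a b y : L}
    (ha : x ⋖ a) (hb : x ⋖ b) (hy : x ⋖ y) (hab : a ≠ b) (hay : a ≠ y) (hby : b ≠ y) :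
    ¬ y ≤ a ⊔ b := by
  intro h
  have inf_eq : ∀ {c d : L}, x ⋖ c → x ⋖ d → c ≠ d → c ⊓ d = x := fun {c d} hc hd hcd =>
    (hc.eq_or_eq (le_inf hc.le hd.le) inf_le_left).resolve_right fun h =>
      hcd ((hd.eq_or_eq hc.le (inf_eq_left.mp h)).resolve_left hc.lt.ne')
  have not_le : ∀ {c d : L}, x ⋖ c → x ⋖ d → c ≠ d → ¬ d ≤ c := fun {c d} hc hd hcd h =>
    hcd ((hc.eq_or_eq hd.le h).resolve_left hd.lt.ne').symm
  have hay' : a ⊔ y = a ⊔ b :=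
    ((covBy_sup_of_covBy_of_not_le hb ha.le (not_le ha hb hab)).eq_or_eq le_sup_left
      (sup_le le_sup_left h)).resolve_left fun h' => not_le ha hy hay (sup_eq_left.mp h')
  have hby' : b ⊔ y = b ⊔ a :=
    ((covBy_sup_of_covBy_of_not_le ha hb.le (not_le hb ha hab.symm)).eq_or_eq le_sup_left
      (sup_le le_sup_left (sup_comm a b ▸ h))).resolve_left
        fun h' => not_le hb hy hby (sup_eq_left.mp h')
  exact hL ⟨a, b, y, hab, hby, hay, by rw [hby', sup_comm], by rw [hby', hay', sup_comm],
    by rw [inf_eq ha hb hab, inf_eq hb hy hby], by rw [inf_eq hb hy hby, inf_eq ha hy hay]⟩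

/-- Extends the statement about three covers of `x` to arbitrary `p` and `q` above `x`. It is what
makes the inf-irreducible attached to a cover unique. -/
theorem IsM3Free.not_le_sup [Finite L] [IsUpperModularLattice L] (hL : IsM3Free L) {x y : L}
    (hxy : x ⋖ y) {p q : L} (hp : x ≤ p) (hq : x ≤ q) (hyp : ¬ y ≤ p) (hyq : ¬ y ≤ q) :
    ¬ y ≤ p ⊔ q := by
  induction x using WellFoundedGT.induction generalizing y p q with
  | ind x ih =>
    -- Replaces `r` by a smaller `t` still strictly above `x`: the induction hypothesis is applied
    -- to the cover `t ⋖ t ⊔ y` with `r` and `t ⊔ s`. Used twice, it reduces `p` and `q` to upper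
    -- covers of `x`.
    have lift : ∀ {r s t : L}, x < t → t ≤ r → x ≤ s → ¬ y ≤ r → ¬ y ≤ t ⊔ s → ¬ y ≤ r ⊔ s := by
      intro r s t hxt htr hxs hyr hyts hyrs
      have hyt : ¬ y ≤ t := fun h => hyr (h.trans htr)
      refine ih t hxt (covBy_sup_of_covBy_of_not_le hxy hxt.le hyt) (p := r) (q := t ⊔ s)
        htr le_sup_left (fun h => hyr (le_sup_right.trans h))
        (fun h => hyts (le_sup_right.trans h)) ?_
      exact sup_le (htr.trans le_sup_left) (hyrs.trans (sup_le_sup_left le_sup_right r))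
    rcases hp.eq_or_lt with rfl | hxp
    · rwa [sup_eq_right.mpr hq]
    rcases hq.eq_or_lt with rfl | hxq
    · rwa [sup_eq_left.mpr hp]
    obtain ⟨a, ha, hap⟩ := exists_covBy_le_of_lt hxp
    obtain ⟨b, hb, hbq⟩ := exists_covBy_le_of_lt hxq
    have hya : ¬ y ≤ a := fun h => hyp (h.trans hap)
    have hyb : ¬ y ≤ b := fun h => hyq (h.trans hbq)
    refine lift ha.lt hap hq hyp ?_
    rw [sup_comm]
    refine lift hb.lt hbq ha.le hyq ?_
    by_cases hab : a = b
    · rwa [hab, sup_idem]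
    · rw [sup_comm]
      exact hL.not_le_sup_of_covBy ha hb hxy hab (fun h => hya h.ge) (fun h => hyb h.ge)

/-- The inf-irreducible elements that do not lie above `x`. -/
def infIrredNotAbove (x : L) : Set {m : L // InfIrred m} := {m | ¬ x ≤ m.1}

theorem infIrredNotAbove_sup (x y : L) :
    infIrredNotAbove (x ⊔ y) = infIrredNotAbove x ∪ infIrredNotAbove y := by
  ext m
  simp only [infIrredNotAbove, Set.mem_ofPred_eq, Set.mem_union, sup_le_iff]
  tauto

theorem infIrredNotAbove_subset_iff [Finite L] {x y : L} :
    infIrredNotAbove x ⊆ infIrredNotAbove y ↔ x ≤ y := by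
  refine ⟨fun h => ?_, fun h m hm hym => hm (h.trans hym)⟩
  by_contra hxy
  obtain ⟨m, hym, hm⟩ := (Set.toFinite {z : L | ¬ x ≤ z}).exists_le_maximal hxy
  -- An element maximal among those not above `x` is inf-irreducible: everything strictly larger
  -- lies above `x`, hence so do meets of such elements.
  have hirr : InfIrred m := by
    refine ⟨fun hmax => hm.prop (le_sup_left.trans (hmax le_sup_right)), fun b c hbc => ?_⟩
    by_contra! hne
    have key : ∀ d, m ≤ d → d ≠ m → x ≤ d := fun d hmd hd => by
      by_contra hxd
      exact hd (le_antisymm (hm.le_of_ge hxd hmd) hmd)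
    exact hm.prop (hbc ▸ le_inf (key b (hbc ▸ inf_le_left) hne.1) (key c (hbc ▸ inf_le_right) hne.2))
  exact h (show (⟨m, hirr⟩ : {m : L // InfIrred m}) ∈ infIrredNotAbove x from hm.prop) hym

/-- A cover adds exactly one inf-irreducible element. -/
theorem IsM3Free.infIrredNotAbove_eq_insert [Finite L] [IsUpperModularLattice L]
    (hL : IsM3Free L) {x y : L} (hxy : x ⋖ y) {m : {m : L // InfIrred m}} (hxm : x ≤ m.1)
    (hym : ¬ y ≤ m.1) : infIrredNotAbove y = insert m (infIrredNotAbove x) := by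
  -- By `not_le_sup`, `q ⊔ p` is not above `y`, so `q` is the meet of its cover `q ⊔ y` with `q ⊔
  -- p`; irreducibility forces `q ⊔ p = q`.
  have key : ∀ p q : {m : L // InfIrred m}, x ≤ p.1 → x ≤ q.1 → ¬ y ≤ p.1 → ¬ y ≤ q.1 →
      p.1 ≤ q.1 := by
    intro p q hxp hxq hyp hyq
    have hcov := covBy_sup_of_covBy_of_not_le hxy hxq hyq
    have hnot := hL.not_le_sup hxy hxq hxp hyq hyp
    have hinf : (q.1 ⊔ y) ⊓ (q.1 ⊔ p.1) = q.1 := by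
      refine (hcov.eq_or_eq (le_inf le_sup_left le_sup_left) inf_le_left).resolve_right fun h => ?_
      exact hnot (le_sup_right.trans (inf_eq_left.mp h))
    exact sup_eq_left.mp ((q.2.2 hinf).resolve_left hcov.lt.ne')
  ext n
  constructor
  · intro hn
    by_cases hxn : x ≤ n.1
    · exact Or.inl (Subtype.ext (le_antisymm (key n m hxn hxm hn hym) (key m n hxm hxn hym hn)))
    · exact Or.inr hxn
  · rintro (rfl | hn)
    · exact hym
    · exact fun h => hn (hxy.le.trans h)

/-- The dependency structure on the inf-irreducible elements of a lattice, whose complete event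
sets are the sets `infIrredNotAbove x`. -/
theorem IsM3Free.exists_rdp_orderIso [Finite L] [Nonempty L] [IsUpperModularLattice L]
    (hL : IsM3Free L) : ∃ A : DSC.{u}, Nonempty (L ≃o A.Rdp) := by
  -- A possible dependency set of `m` comes from each cover `x ⋖ y` at which `m` stops being an
  -- upper bound.
  let A₀ : PreDSC.{u} :=
    { Event := {m : L // InfIrred m}
      dep := fun m => {X | ∃ x y : L, x ⋖ y ∧ x ≤ m.1 ∧ ¬ y ≤ m.1 ∧ X = infIrredNotAbove x}
      dep_nonempty := fun m => by
        obtain ⟨y, hy⟩ := not_isMax_iff.mp m.2.1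
        obtain ⟨z, hz, -⟩ := exists_covBy_le_of_lt hy
        exact ⟨_, m.1, z, hz, le_rfl, hz.lt.not_ge, rfl⟩ }
  have hcomplete : ∀ x : L, A₀.IsComplete (infIrredNotAbove x) := by
    intro x m hm
    -- A minimal `z ≤ x` not below `m` has a lower cover `w ≥ z ⊓ m`, and minimality puts `w` below
    -- `m`; so `w ⋖ z` is a cover of the required kind.
    obtain ⟨z, hzx, hz⟩ := (Set.toFinite {z : L | ¬ z ≤ m.1}).exists_le_minimal hm
    have hlt : z ⊓ m.1 < z := lt_of_le_of_ne inf_le_left fun h => hz.prop (inf_eq_left.mp h)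
    obtain ⟨w, -, hw⟩ := exists_le_covBy_of_lt hlt
    have hwm : w ≤ m.1 := by
      by_contra h
      exact hw.lt.not_ge (hz.le_of_le h hw.le)
    exact ⟨_, ⟨w, z, hw, hwm, hz.prop, rfl⟩, infIrredNotAbove_subset_iff.mpr (hw.le.trans hzx)⟩
  let A : DSC.{u} :=
    { A₀ with
      dep_complete := by
        rintro m X ⟨x, y, -, -, -, rfl⟩
        exact hcomplete x
      dep_acyclic := by
        rintro m X ⟨x, y, -, hxm, -, rfl⟩ hm
        exact hm hxm }
  let φ : L ↪o A.Rdp := OrderEmbedding.ofMapLEIff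
    (fun x => A.mkRdp (infIrredNotAbove x) (hcomplete x))
    fun x y => A.rdp_le_iff.trans infIrredNotAbove_subset_iff
  refine ⟨A, ⟨OrderIso.ofSurjective φ fun X => ?_⟩⟩
  -- The least element of `L` lies below every inf-irreducible, so its set is empty.
  have hbot : ∃ x : L, infIrredNotAbove x ⊆ X.1 := by
    obtain ⟨b, hb⟩ := Finite.exists_le_minimal (p := fun _ : L => True)
      (a := Classical.arbitrary L) trivial
    exact ⟨b, fun m hm => (hm ((hb.2.le_of_le (y := b ⊓ m.1) trivial inf_le_left).trans
      inf_le_right)).elim⟩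
  obtain ⟨x, hx⟩ := (Set.toFinite {x : L | infIrredNotAbove x ⊆ X.1}).exists_maximal hbot
  refine ⟨x, Subtype.ext (hx.prop.antisymm fun m hm => ?_)⟩
  obtain ⟨_, ⟨w, z, hwz, hwm, hzm, rfl⟩, hwX⟩ := X.isComplete m hm
  -- The cover `w ⋖ z` adds only `m`, which is in `X`, so maximality of `x` gives `z ≤ x`.
  have hxz : infIrredNotAbove (x ⊔ z) ⊆ X.1 := by
    rw [infIrredNotAbove_sup, hL.infIrredNotAbove_eq_insert hwz hwm hzm]
    exact Set.union_subset hx.prop (Set.insert_subset hm hwX)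
  exact fun hxm => hzm ((le_sup_right.trans (hx.le_of_ge hxz le_sup_left)).trans hxm)

end Lattice

/-! Posites -/

theorem JoinIrreducible.map {P Q : Type u} [PartialOrder P] [PartialOrder Q] (φ : P ≃o Q) {x : P}
    (hx : JoinIrreducible x) : JoinIrreducible (φ x) := by
  intro S hS
  have h : IsLUB (φ ⁻¹' S) x := by
    rw [← φ.isLUB_image', φ.image_preimage]
    exact hS
  exact hx _ h

theorem supIrred_map_orderIso {α β : Type*} [SemilatticeSup α] [SemilatticeSup β] (φ : α ≃o β)
    {x : α} (hx : SupIrred x) : SupIrred (φ x) := by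
  refine ⟨fun h => hx.1 ((OrderIso.isMin_apply φ).mp h), fun b c hbc => ?_⟩
  have h : φ.symm b ⊔ φ.symm c = x := by
    rw [← φ.symm.map_sup, hbc, φ.symm_apply_apply]
  simpa only [φ.symm_apply_eq] using hx.2 h

/-- The Bruns-Lakser posites of two finite posets are isomorphic iff the posets are. -/
theorem FinPosite.ofPoset_equiv_iff {P Q : Type u} [PartialOrder P] [Finite P] [PartialOrder Q]
    [Finite Q] : FinPosite.ofPoset P ≈ FinPosite.ofPoset Q ↔ Nonempty (P ≃o Q) := by
  constructor
  -- The frame alone suffices: a finite poset is recovered as the sup-irreducible downsets, so the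
  -- nucleus is discarded.
  · rintro ⟨φ, -⟩
    change LowerSet P ≃o LowerSet Q at φ
    let ψ : {s : LowerSet P // SupIrred s} ≃o {s : LowerSet Q // SupIrred s} :=
      { toEquiv := φ.toEquiv.subtypeEquiv fun s => ⟨fun h => supIrred_map_orderIso φ h, fun h => by
          have := supIrred_map_orderIso φ.symm h
          exact (φ.symm_apply_apply s) ▸ this⟩
        map_rel_iff' := φ.le_iff_le }
    exact ⟨OrderIso.supIrredLowerSet.trans (ψ.trans OrderIso.supIrredLowerSet.symm)⟩
  · rintro ⟨φ⟩
    refine ⟨LowerSet.map φ, fun U => ?_⟩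
    change LowerSet.map φ (brunsLakser P U) = brunsLakser Q (LowerSet.map φ U)
    ext y
    constructor
    · rintro ⟨x, hx, rfl⟩ a ha hax
      refine ⟨φ.symm a, hx _ (ha.map φ.symm) (φ.symm_apply_le.mpr hax), φ.apply_symm_apply a⟩
    · intro hy
      refine ⟨φ.symm y, fun a ha hay => ?_, φ.apply_symm_apply y⟩
      obtain ⟨b, hb, hba⟩ := hy (φ a) (ha.map φ) (φ.le_symm_apply.mp hay)
      rwa [← φ.injective hba]

theorem FinPosite.mk_ofPoset_eq_iff {P Q : Type u} [PartialOrder P] [Finite P] [PartialOrder Q]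
    [Finite Q] : Quotient.mk FinPosite.setoid (FinPosite.ofPoset P) =
      Quotient.mk FinPosite.setoid (FinPosite.ofPoset Q) ↔ Nonempty (P ≃o Q) :=
  Quotient.eq.trans FinPosite.ofPoset_equiv_iff

/-! ### The two bijections. -/

theorem exists_quotient_equiv {α β : Type*} (s : Setoid α) {S : Set β} (F : α → β)
    (hF : ∀ a, F a ∈ S) (hinj : ∀ a b, s.r a b ↔ F a = F b) (hsurj : ∀ c ∈ S, ∃ a, F a = c) :
    ∃ Φ : Quotient s ≃ S, ∀ a, (Φ (Quotient.mk s a)).1 = F a := by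
  refine ⟨Equiv.ofBijective
    (Quotient.lift (fun a => (⟨F a, hF a⟩ : S)) fun a b h => Subtype.ext ((hinj a b).mp h))
    ⟨?_, ?_⟩, fun a => rfl⟩
  · rintro ⟨a⟩ ⟨b⟩ h
    exact Quotient.sound ((hinj a b).mpr (congrArg Subtype.val h))
  · rintro ⟨c, hc⟩
    obtain ⟨a, rfl⟩ := hsurj c hc
    exact ⟨Quotient.mk s a, rfl⟩

theorem DSC.mk_rdp_mem_brunsLakserPosites (A : DSC.{u}) :
    Quotient.mk _ (FinPosite.ofPoset A.Rdp) ∈ brunsLakserPosites.{u} :=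
  ⟨A.Rdp, inferInstance, inferInstance, inferInstance, A.isUpperModularLattice_rdp,
    A.isM3Free_rdp, rfl⟩

theorem exists_mk_rdp_eq {c : Quotient FinPosite.setoid.{u}} (hc : c ∈ brunsLakserPosites.{u}) :
    ∃ A : DSC.{u}, Quotient.mk _ (FinPosite.ofPoset A.Rdp) = c := by
  obtain ⟨L, _, _, _, _, hL, rfl⟩ := hc
  obtain ⟨A, ⟨φ⟩⟩ := hL.exists_rdp_orderIso
  exact ⟨A, FinPosite.mk_ofPoset_eq_iff.mpr ⟨φ.symm⟩⟩

theorem DSC.equivalent_iff_mk_rdp_eq {A B : DSC.{u}} : DSC.Equivalent A B ↔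
    Quotient.mk FinPosite.setoid (FinPosite.ofPoset A.Rdp) =
      Quotient.mk FinPosite.setoid (FinPosite.ofPoset B.Rdp) :=
  DSC.equivalent_iff_nonempty_rdp_orderIso.trans FinPosite.mk_ofPoset_eq_iff.symm

end DepChoice

theorem mainTheorem2 :
    (∃ Φ : Quotient DepChoice.DSC.setoid.{u} ≃ DepChoice.brunsLakserPosites.{u},
      ∀ A : DepChoice.DSC.{u},
        (Φ (Quotient.mk _ A)).1 = Quotient.mk _ (DepChoice.FinPosite.ofPoset A.Rdp)) ∧
    (∃ Ψ : Quotient DepChoice.DSC.irredundantSetoid.{u} ≃ DepChoice.brunsLakserPosites.{u},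
      ∀ A : {A : DepChoice.DSC.{u} // A.IsIrredundant},
        (Ψ (Quotient.mk _ A)).1 = Quotient.mk _ (DepChoice.FinPosite.ofPoset A.1.Rdp)) := by
  refine ⟨DepChoice.exists_quotient_equiv _ _ (fun A => A.mk_rdp_mem_brunsLakserPosites)
      (fun A B => DepChoice.DSC.equivalent_iff_mk_rdp_eq)
      (fun c hc => DepChoice.exists_mk_rdp_eq hc),
    DepChoice.exists_quotient_equiv _ _ (fun A => A.1.mk_rdp_mem_brunsLakserPosites)
      (fun A B => (DepChoice.DSC.renaming_iff_equivalent A.2 B.2).trans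
        DepChoice.DSC.equivalent_iff_mk_rdp_eq) fun c hc => ?_⟩
  obtain ⟨A, rfl⟩ := DepChoice.exists_mk_rdp_eq hc
  obtain ⟨B, hB, hBA⟩ := A.exists_isIrredundant_equivalent
  exact ⟨⟨B, hB⟩, DepChoice.DSC.equivalent_iff_mk_rdp_eq.mp hBA⟩
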